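/- All graphs are finite and simple. A burning process of a graph $G$ proceeds in rounds: initially all vertices are unburned; in each round $r\ge 1$ one chooses a vertex $x_r$ that is still unburned (the source of round $r$) and burns $x_r$ together with all unburned vertices adjacent to a vertex burned in an earlier round. Burned vertices remain burned, and the process terminates once all vertices are burned. If it terminates in $k$ rounds, $(x_1,\dots,x_k)$ is called a burning sequence of length $k$ for $G$; the burning number $b(G)$ is the minimum length of a burning sequence for $G$. Let $G$ be a graph of order $n$. If $G$ has a spanning tree $T$ such that $T$ contains at most $\lfloor\sqrt{n-1}\rfloor$ vertices of degree $2$ (degree taken in $T$), then $b(G)\le\lceil\sqrt{n}\,\rceil$. -/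

import Mathlib

/-- The set of vertices of `G` that are burned at the end of round `r`, when `x i` is the source
of round `i + 1`: nothing is burned at the start, and in each round the source of that round and
all neighbours of the already burned vertices become burned; burned vertices stay burned. -/
def SimpleGraph.burnedAfter {V : Type*} (G : SimpleGraph V) {k : ℕ} (x : Fin k → V) : ℕ → Set V
  | 0 => ∅
  | r + 1 => {v | v ∈ G.burnedAfter x r ∨ (∃ u ∈ G.burnedAfter x r, G.Adj u v) ∨
      ∃ h : r < k, v = x ⟨r, h⟩}

/-- `x` is a burning sequence of length `k` for `G`: every source is unburned when it is chosen,
and all vertices are burned at the end of round `k`. Because the source of each round is unburned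
when it is chosen, the process cannot have terminated before round `k`. -/
structure SimpleGraph.IsBurningSequence {V : Type*} (G : SimpleGraph V) {k : ℕ} (x : Fin k → V) :
    Prop where
  source_unburned : ∀ i : Fin k, x i ∉ G.burnedAfter x i
  all_burned : G.burnedAfter x k = Set.univ

/-- The burning number of `G`: the minimum length of a burning sequence for `G`. -/
noncomputable def SimpleGraph.burningNumber {V : Type*} (G : SimpleGraph V) : ℕ :=
  sInf {k : ℕ | ∃ x : Fin k → V, G.IsBurningSequence x}

/-- The first rounds do not depend on a later source. -/
theorem SimpleGraph.burnedAfter_snoc {V : Type*} (G : SimpleGraph V) {k : ℕ} (x : Fin k → V)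
    (v : V) (r : ℕ) (hr : r ≤ k) :
    G.burnedAfter (Fin.snoc x v : Fin (k + 1) → V) r = G.burnedAfter x r := by
  induction r with
  | zero => rfl
  | succ r ih =>
    have hrk : r < k := hr
    have hx : (Fin.snoc x v : Fin (k + 1) → V) ⟨r, by omega⟩ = x ⟨r, hrk⟩ :=
      Fin.snoc_castSucc (α := fun _ => V) v x ⟨r, hrk⟩
    ext w
    simp only [SimpleGraph.burnedAfter, ih hrk.le, Set.mem_ofPred_eq, hx, hrk,
      Nat.lt_succ_of_lt hrk, exists_true_left]

/-- A finite graph has a burning sequence, so the minimum that defines the burning number is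
taken over a nonempty set. -/
theorem SimpleGraph.exists_isBurningSequence {V : Type*} [Finite V] (G : SimpleGraph V) :
    ∃ (k : ℕ) (x : Fin k → V), G.IsBurningSequence x := by
  by_contra hcon
  push Not at hcon
  have key : ∀ k : ℕ, ∃ x : Fin k → V, (∀ i : Fin k, x i ∉ G.burnedAfter x i) ∧
      k ≤ (G.burnedAfter x k).ncard := by
    intro k
    induction k with
    | zero => exact ⟨Fin.elim0, fun i => i.elim0, Nat.zero_le _⟩
    | succ k ih =>
      obtain ⟨x, hx, hk⟩ := ih
      have hne : G.burnedAfter x k ≠ Set.univ := fun h => hcon k x ⟨hx, h⟩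
      obtain ⟨v, hv⟩ := (Set.ne_univ_iff_exists_notMem _).1 hne
      have hlast : (Fin.snoc x v : Fin (k + 1) → V) ⟨k, Nat.lt_succ_self k⟩ = v :=
        Fin.snoc_last (α := fun _ => V) v x
      refine ⟨Fin.snoc x v, ?_, ?_⟩
      · intro i
        rw [SimpleGraph.burnedAfter_snoc G x v i (Nat.le_of_lt_succ i.2)]
        refine Fin.lastCases ?_ (fun j => ?_) i
        · simpa using hv
        · simpa using hx j
      · have hsub : insert v (G.burnedAfter x k) ⊆
            G.burnedAfter (Fin.snoc x v : Fin (k + 1) → V) (k + 1) := by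
          intro w hw
          rcases hw with rfl | hw
          · exact Or.inr (Or.inr ⟨Nat.lt_succ_self k, hlast.symm⟩)
          · exact Or.inl (by rwa [SimpleGraph.burnedAfter_snoc G x v k le_rfl])
        have h1 := Set.ncard_le_ncard hsub (Set.toFinite _)
        rw [Set.ncard_insert_of_notMem hv (Set.toFinite _)] at h1
        omega
  obtain ⟨x, -, hx⟩ := key (Nat.card V + 1)
  have := Set.ncard_le_card (G.burnedAfter x (Nat.card V + 1))
  omega

/-- On a finite graph the burning number is attained. -/
theorem SimpleGraph.isLeast_burningNumber {V : Type*} [Finite V] (G : SimpleGraph V) :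
    IsLeast {k : ℕ | ∃ x : Fin k → V, G.IsBurningSequence x} G.burningNumber :=
  ⟨Nat.sInf_mem G.exists_isBurningSequence, fun _ hk => Nat.sInf_le hk⟩

/-! ### From burning sequences to covers by balls -/

namespace SimpleGraph

variable {V : Type*}

/-! Burning in `k` rounds amounts to covering by balls of radii `0, …, k - 1`. Put `k = ⌈√n⌉`. A
degree count in `T` shows that few degree-2 vertices force many leaves: twice the number of
non-leaves is at most `n + (k - 1) - 2 ≤ k² + k - 3`. It therefore suffices to cover the non-leaves
by balls of radii `0, …, k - 2`; enlarging each radius by one also catches the leaves.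

The cover is greedy (`exists_cover`). In a rooted tree, the subtree below the `r`-th ancestor of a
deepest vertex lies in one ball of radius `r` and has at least `r + 1` vertices (`exists_remove`).
Once the smaller radii are used, so few vertices remain that the largest ball covers them, centred
near the middle of a longest path (`exists_center`). -/

theorem mem_burnedAfter_of_walk (G : SimpleGraph V) {k : ℕ} (x : Fin k → V) {u v : V}
    (w : G.Walk u v) (s r : ℕ) (hu : u ∈ G.burnedAfter x s) (hr : s + w.length ≤ r) :
    v ∈ G.burnedAfter x r := by
  induction w generalizing s with
  | nil =>
    induction r, (show s ≤ r by simpa using hr) using Nat.le_induction with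
    | base => exact hu
    | succ r hsr ih => exact Or.inl (ih (by simpa using hsr))
  | cons h w ih =>
    rw [Walk.length_cons] at hr
    exact ih (s + 1) (Or.inr (Or.inl ⟨_, hu, h⟩)) (by omega)

/-- Sources that are already burned when they are chosen can be replaced by unburned ones. -/
theorem exists_isBurningSequence_of_burnedAfter_eq_univ (G : SimpleGraph V) {k : ℕ}
    (x : Fin k → V) (hx : G.burnedAfter x k = Set.univ) :
    ∃ j ≤ k, ∃ y : Fin j → V, G.IsBurningSequence y := by
  by_contra! hcon
  have key : ∀ r ≤ k, ∃ y : Fin r → V, (∀ i : Fin r, y i ∉ G.burnedAfter y i) ∧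
      G.burnedAfter x r ⊆ G.burnedAfter y r := by
    intro r
    induction r with
    | zero => exact fun _ => ⟨Fin.elim0, fun i => i.elim0, subset_rfl⟩
    | succ r ih =>
      intro hr
      obtain ⟨y, hy, hsub⟩ := ih (by omega)
      have hne : G.burnedAfter y r ≠ Set.univ := fun h => hcon r (by omega) y ⟨hy, h⟩
      -- Keep the source of `x` if it is unburned; otherwise any unburned vertex will do.
      obtain ⟨v, hv, hvx⟩ : ∃ v, v ∉ G.burnedAfter y r ∧
          (x ⟨r, hr⟩ ∈ G.burnedAfter y r ∨ v = x ⟨r, hr⟩) := by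
        by_cases h : x ⟨r, hr⟩ ∈ G.burnedAfter y r
        · obtain ⟨v, hv⟩ := (Set.ne_univ_iff_exists_notMem _).1 hne
          exact ⟨v, hv, Or.inl h⟩
        · exact ⟨_, h, Or.inr rfl⟩
      have hlast : (Fin.snoc y v : Fin (r + 1) → V) ⟨r, Nat.lt_succ_self r⟩ = v :=
        Fin.snoc_last (α := fun _ => V) v y
      have hs := G.burnedAfter_snoc y v r le_rfl
      refine ⟨Fin.snoc y v, fun i => ?_, ?_⟩
      · rw [G.burnedAfter_snoc y v i (Nat.le_of_lt_succ i.2)]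
        refine Fin.lastCases ?_ (fun j => ?_) i
        · simpa using hv
        · simpa using hy j
      · rintro w (hw | ⟨u, hu, huw⟩ | ⟨-, rfl⟩)
        · exact Or.inl (hs ▸ hsub hw)
        · exact Or.inr (Or.inl ⟨u, hs ▸ hsub hu, huw⟩)
        · rcases hvx with h | h
          · exact Or.inl (hs ▸ h)
          · exact Or.inr (Or.inr ⟨Nat.lt_succ_self r, by rw [hlast, h]⟩)
  obtain ⟨y, hy, hsub⟩ := key k le_rfl
  exact hcon k le_rfl y ⟨hy, Set.univ_subset_iff.1 (hx ▸ hsub)⟩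

/-- If walks of length at most `r` from the centres `c r`, `r < k`, reach all vertices,
then the burning number is at most `k`. -/
theorem burningNumber_le_of_cover (G : SimpleGraph V) (k : ℕ) (c : ℕ → V)
    (hc : ∀ v, ∃ r < k, ∃ w : G.Walk (c r) v, w.length ≤ r) : G.burningNumber ≤ k := by
  -- Centres are lit in order of decreasing radius: `c r` burns in round `k - r`, leaving `r` rounds
  -- to spread.
  have hx : G.burnedAfter (fun i : Fin k => c (k - 1 - i)) k = Set.univ := by
    refine Set.eq_univ_of_forall fun v => ?_
    obtain ⟨r, hr, w, hw⟩ := hc v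
    have hmem : c r ∈ G.burnedAfter (fun i : Fin k => c (k - 1 - i)) (k - 1 - r + 1) :=
      Or.inr (Or.inr ⟨by omega, congrArg c (show r = k - 1 - (k - 1 - r) by omega)⟩)
    exact G.mem_burnedAfter_of_walk _ w _ _ hmem (by omega)
  obtain ⟨j, hj, y, hy⟩ := G.exists_isBurningSequence_of_burnedAfter_eq_univ _ hx
  have hle : G.burningNumber ≤ j := Nat.sInf_le ⟨y, hy⟩
  exact hle.trans hj

end SimpleGraph

/-! ### Covering rooted trees by balls -/

/-- A parent function with its depth: the roots have depth `0` and are their own parents. -/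
structure IsParentDepth {V : Type*} (p : V → V) (d : V → ℕ) : Prop where
  depth_parent : ∀ v, d (p v) = d v - 1
  parent_eq_self : ∀ v, d v = 0 → p v = v

namespace IsParentDepth

variable {V : Type*} {p : V → V} {d : V → ℕ}

theorem depth_iterate (h : IsParentDepth p d) (i : ℕ) (v : V) : d (p^[i] v) = d v - i := by
  induction i with
  | zero => rfl
  | succ i ih => rw [Function.iterate_succ_apply', h.depth_parent, ih, Nat.sub_sub]

theorem iterate_mem {A : Finset V} (hA : ∀ v ∈ A, p v ∈ A) {v : V} (hv : v ∈ A) (i : ℕ) :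
    p^[i] v ∈ A := by
  induction i with
  | zero => exact hv
  | succ i ih => rw [Function.iterate_succ_apply']; exact hA _ ih

theorem iterate_injOn (h : IsParentDepth p d) (v : V) :
    Set.InjOn (fun i => p^[i] v) (Set.Iic (d v)) := by
  intro i hi j hj hij
  have := congrArg d hij
  simp only [h.depth_iterate, Set.mem_Iic] at this hi hj
  omega

/-- From a parent-closed set one can remove at least `r + 1` vertices within distance `r` of a
vertex, or everything, and keep the set parent-closed. -/
theorem exists_remove [DecidableEq V] (h : IsParentDepth p d) {A : Finset V}
    (hA : ∀ v ∈ A, p v ∈ A) (hne : ∀ u v, d u = 0 → d v = 0 → u = v) (c₀ : V) (r : ℕ) :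
    ∃ c, ∃ B ⊆ A, (∀ v ∈ B, p v ∈ B) ∧ (∀ u ∈ A \ B, ∃ j ≤ r, p^[j] u = c) ∧
      (B = ∅ ∨ B.card + (r + 1) ≤ A.card) := by
  classical
  rcases A.eq_empty_or_nonempty with rfl | hAne
  · exact ⟨c₀, ∅, subset_rfl, by simp, by simp, Or.inl rfl⟩
  obtain ⟨v, hv, hmax⟩ := A.exists_max_image d hAne
  rcases Nat.lt_or_ge (d v) r with hD | hD
  · refine ⟨p^[r] v, ∅, Finset.empty_subset _, by simp, fun u hu => ⟨r, le_rfl, ?_⟩, Or.inl rfl⟩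
    have := hmax u (by simpa using hu)
    exact hne _ _ (by rw [h.depth_iterate]; omega) (by rw [h.depth_iterate]; omega)
  -- Remove all descendants of the `r`-th ancestor of the deepest vertex `v`; the path from `v` up
  -- to it supplies `r + 1` of them.
  · have hsub : (Finset.range (r + 1)).image (fun i => p^[i] v) ⊆
        A.filter fun u => ∃ j, p^[j] u = p^[r] v := by
      intro u hu
      obtain ⟨i, hi, rfl⟩ := Finset.mem_image.1 hu
      have hi := Finset.mem_range.1 hi
      refine Finset.mem_filter.2 ⟨iterate_mem hA hv i, r - i, ?_⟩
      rw [← Function.iterate_add_apply, Nat.sub_add_cancel (by omega)]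
    have hcard := Finset.card_le_card hsub
    rw [Finset.card_image_of_injOn ((h.iterate_injOn v).mono fun i hi => by
      have := Finset.mem_range.1 hi
      exact Set.mem_Iic.2 (by omega)), Finset.card_range] at hcard
    have hadd := Finset.card_filter_add_card_filter_not (s := A) (fun u => ∃ j, p^[j] u = p^[r] v)
    refine ⟨p^[r] v, A.filter fun u => ¬ ∃ j, p^[j] u = p^[r] v, Finset.filter_subset _ _,
      fun u hu => ?_, fun u hu => ?_, Or.inr (by omega)⟩
    · obtain ⟨hu, hn⟩ := Finset.mem_filter.1 hu
      exact Finset.mem_filter.2 ⟨hA u hu, fun ⟨j, hj⟩ => hn ⟨j + 1, hj⟩⟩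
    · simp only [Finset.mem_sdiff, Finset.mem_filter, not_and, not_not] at hu
      obtain ⟨hu, hj⟩ := hu
      have hj := hj hu
      refine ⟨Nat.find hj, ?_, Nat.find_spec hj⟩
      have hdep := congrArg d (Nat.find_spec hj)
      rw [h.depth_iterate, h.depth_iterate] at hdep
      have hmu := hmax u hu
      -- Since `u` is no deeper than `v`, needing more than `r` steps is possible only if depths are
      -- truncated at the root; but then `p^[r] u` is already the root.
      by_contra! hlt
      have hr0 : p^[r] u ≠ p^[r] v := Nat.find_min hj hlt
      exact hr0 (hne _ _ (by rw [h.depth_iterate]; omega) (by rw [h.depth_iterate]; omega))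

/-- A parent-closed set of at most `2 * R + 1` vertices lies within distance `R` of a vertex. -/
theorem exists_center [DecidableEq V] (h : IsParentDepth p d) {A : Finset V}
    (hA : ∀ v ∈ A, p v ∈ A) (hne : ∀ u v, d u = 0 → d v = 0 → u = v) (c₀ : V) (R : ℕ)
    (hcard : A.card ≤ 2 * R + 1) :
    ∃ c, ∀ u ∈ A, ∃ a b, a + b ≤ R ∧ p^[a] u = p^[b] c := by
  classical
  rcases A.eq_empty_or_nonempty with rfl | hAne
  · exact ⟨c₀, by simp⟩
  obtain ⟨v, hv, hmax⟩ := A.exists_max_image d hAne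
  -- Let the path up from `u` first meet the ancestors of `v` after `j` steps, at `p^[i] v`. The two
  -- disjoint path pieces give `d v + 1 + j ≤ 2 * R + 1`, which settles `R ≤ i`. For `i ≤ R`,
  -- maximality of `d v` gives `j ≤ i`, so `R - i + j ≤ R`.
  refine ⟨p^[R] v, fun u hu => ?_⟩
  have hduv := hmax u hu
  have hex : ∃ j, p^[j] u ∈ (Finset.range (d v + 1)).image fun i => p^[i] v :=
    ⟨d u, Finset.mem_image.2 ⟨d v, by simp,
      hne _ _ (by rw [h.depth_iterate]; omega) (by rw [h.depth_iterate]; omega)⟩⟩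
  -- This keeps the subtraction `d u - j` from truncating.
  have hju : Nat.find hex ≤ d u := Nat.find_min' hex (Finset.mem_image.2 ⟨d v, by simp,
      hne _ _ (by rw [h.depth_iterate]; omega) (by rw [h.depth_iterate]; omega)⟩)
  have hmin := fun l (hl : l < Nat.find hex) => Nat.find_min hex hl
  obtain ⟨i, hi, hij⟩ := Finset.mem_image.1 (Nat.find_spec hex)
  generalize Nat.find hex = j at hju hmin hij
  have hi := Finset.mem_range.1 hi
  have hdisj : Disjoint ((Finset.range (d v + 1)).image fun i => p^[i] v)
      ((Finset.range j).image fun i => p^[i] u) := by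
    rw [Finset.disjoint_right]
    intro w hw
    obtain ⟨l, hl, rfl⟩ := Finset.mem_image.1 hw
    exact hmin l (Finset.mem_range.1 hl)
  have hle : (((Finset.range (d v + 1)).image fun i => p^[i] v) ∪
      ((Finset.range j).image fun i => p^[i] u)).card ≤ A.card := by
    refine Finset.card_le_card (Finset.union_subset ?_ ?_) <;> intro w hw <;>
      obtain ⟨l, -, rfl⟩ := Finset.mem_image.1 hw
    exacts [iterate_mem hA hv l, iterate_mem hA hu l]
  rw [Finset.card_union_of_disjoint hdisj,
    Finset.card_image_of_injOn ((h.iterate_injOn v).mono fun i hi => by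
      have := Finset.mem_range.1 hi
      exact Set.mem_Iic.2 (by omega)),
    Finset.card_image_of_injOn ((h.iterate_injOn u).mono fun i hi => by
      have := Finset.mem_range.1 hi
      exact Set.mem_Iic.2 (by omega)), Finset.card_range, Finset.card_range] at hle
  have hdep := congrArg d hij
  simp only [h.depth_iterate] at hdep hij
  rcases le_total R i with hRi | hRi
  · refine ⟨j, i - R, by omega, ?_⟩
    rw [← Function.iterate_add_apply, Nat.sub_add_cancel hRi, hij]
  · refine ⟨R - i + j, 0, by omega, ?_⟩
    rw [Function.iterate_add_apply, ← hij, ← Function.iterate_add_apply, Nat.sub_add_cancel hRi]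
    rfl

/-- A parent-closed set of at most `(s ^ 2 + 5 * s + 2) / 2` vertices is covered by balls of the
radii `0, 1, …, s`. -/
theorem exists_cover [DecidableEq V] (h : IsParentDepth p d) {A : Finset V}
    (hA : ∀ v ∈ A, p v ∈ A) (hne : ∀ u v, d u = 0 → d v = 0 → u = v) (c₀ : V) (s : ℕ)
    (hcard : 2 * A.card ≤ s * s + 5 * s + 2) :
    ∃ c : ℕ → V, ∀ u ∈ A, ∃ r ≤ s, ∃ a b, a + b ≤ r ∧ p^[a] u = p^[b] (c r) := by
  have key : ∀ j, ∃ c : ℕ → V, ∃ B ⊆ A, (∀ v ∈ B, p v ∈ B) ∧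
      (∀ u ∈ A \ B, ∃ r < j, ∃ a b, a + b ≤ r ∧ p^[a] u = p^[b] (c r)) ∧
      (B = ∅ ∨ 2 * B.card + (j * j + j) ≤ 2 * A.card) := by
    intro j
    induction j with
    | zero => exact ⟨fun _ => c₀, A, subset_rfl, hA, by simp, Or.inr (by simp)⟩
    | succ j ih =>
      obtain ⟨c, B, hBA, hB, hc, hBc⟩ := ih
      obtain ⟨c', B', hBB', hB', hc', hBc'⟩ := h.exists_remove hB hne c₀ j
      refine ⟨Function.update c j c', B', hBB'.trans hBA, hB', fun u hu => ?_, ?_⟩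
      · rw [Finset.mem_sdiff] at hu
        by_cases huB : u ∈ B
        · obtain ⟨a, ha, hac⟩ := hc' u (Finset.mem_sdiff.2 ⟨huB, hu.2⟩)
          exact ⟨j, by omega, a, 0, by omega, by simpa using hac⟩
        · obtain ⟨r, hr, a, b, hab, hac⟩ := hc u (Finset.mem_sdiff.2 ⟨hu.1, huB⟩)
          refine ⟨r, by omega, a, b, hab, ?_⟩
          rwa [Function.update_of_ne hr.ne]
      · rcases hBc' with h' | h'
        · exact Or.inl h'
        · rcases hBc with rfl | hBc
          · simp at h'
          · right
            linarith
  obtain ⟨c, B, -, hB, hc, hBc⟩ := key s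
  -- The radii below `s` removed `s * (s + 1) / 2` vertices unless nothing is left, so at most `2 *
  -- s + 1` remain.
  obtain ⟨c', hc'⟩ := h.exists_center hB hne c₀ s (by
    rcases hBc with rfl | hBc
    · simp
    · linarith)
  refine ⟨Function.update c s c', fun u hu => ?_⟩
  by_cases huB : u ∈ B
  · exact ⟨s, le_rfl, by simpa using hc' u huB⟩
  · obtain ⟨r, hr, a, b, hab, hac⟩ := hc u (Finset.mem_sdiff.2 ⟨hu, huB⟩)
    refine ⟨r, hr.le, a, b, hab, ?_⟩
    rwa [Function.update_of_ne hr.ne]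

end IsParentDepth

/-! ### Leaves of the spanning tree and the burning bound -/

namespace SimpleGraph

variable {V : Type*} {T : SimpleGraph V}

/-- The parent is the next vertex on a shortest path to `ρ`. -/
theorem Connected.exists_isParentDepth (hT : T.Connected) (ρ : V) :
    ∃ p : V → V, IsParentDepth p (T.dist ρ) ∧ p ρ = ρ ∧ ∀ v ≠ ρ, T.Adj v (p v) := by
  have step : ∀ v, ∃ u, T.dist ρ u = T.dist ρ v - 1 ∧ (v = ρ → u = ρ) ∧ (v ≠ ρ → T.Adj v u) := by
    intro v
    by_cases hv : v = ρ
    · exact ⟨ρ, by simp [hv], fun _ => rfl, fun h => absurd hv h⟩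
    obtain ⟨w, hw⟩ := hT.exists_walk_length_eq_dist v ρ
    cases w with
    | nil => exact absurd rfl hv
    | @cons _ u _ h w =>
      refine ⟨u, ?_, fun h' => absurd h' hv, fun _ => h⟩
      rw [dist_comm (u := ρ), dist_comm (u := ρ), ← hw, Walk.length_cons]
      have h1 := dist_le w
      have h2 := dist_le (Walk.cons h (hT.exists_walk_length_eq_dist u ρ).choose)
      rw [Walk.length_cons, (hT.exists_walk_length_eq_dist u ρ).choose_spec] at h2
      rw [Walk.length_cons] at hw
      omega
  choose p hp using step
  refine ⟨p, ⟨fun v => (hp v).1, fun v hv => ?_⟩, (hp ρ).2.1 rfl, fun v => (hp v).2.2⟩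
  have : ρ = v := hT.dist_eq_zero_iff.1 hv
  rw [(hp v).2.1 this.symm, this]

theorem exists_walk_iterate {p : V → V} (hp : ∀ v, p v = v ∨ T.Adj v (p v)) (i : ℕ) (v : V) :
    ∃ w : T.Walk v (p^[i] v), w.length ≤ i := by
  induction i generalizing v with
  | zero => exact ⟨Walk.nil, le_rfl⟩
  | succ i ih =>
    obtain ⟨w, hw⟩ := ih (p v)
    rw [Function.iterate_succ_apply]
    rcases hp v with h | h
    · refine ⟨w.copy h rfl, ?_⟩
      rw [Walk.length_copy]
      omega
    · exact ⟨Walk.cons h w, by rw [Walk.length_cons]; omega⟩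

theorem exists_walk_of_iterate_eq {p : V → V} (hp : ∀ v, p v = v ∨ T.Adj v (p v)) {a b : ℕ}
    {u c : V} (h : p^[a] u = p^[b] c) : ∃ w : T.Walk c u, w.length ≤ a + b := by
  obtain ⟨w₁, h₁⟩ := exists_walk_iterate hp a u
  obtain ⟨w₂, h₂⟩ := exists_walk_iterate hp b c
  refine ⟨w₂.append (w₁.copy rfl h).reverse, ?_⟩
  rw [Walk.length_append, Walk.length_reverse, Walk.length_copy]
  omega

/-- Each vertex of degree at least three of a tree accounts for at least one leaf. -/
theorem IsTree.two_mul_card_degree_ne_one_add_two_le [Fintype V] [DecidableRel T.Adj]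
    (hT : T.IsTree) (hcard : 2 ≤ Fintype.card V) :
    2 * (Finset.univ.filter fun v => T.degree v ≠ 1).card + 2 ≤
      Fintype.card V + (Finset.univ.filter fun v => T.degree v = 2).card := by
  classical
  have : Nontrivial V := Fintype.one_lt_card_iff_nontrivial.1 hcard
  have hsum := T.sum_degrees_eq_twice_card_edges
  have hedge := hT.card_edgeFinset
  -- Summed over `v`, this is compared with the degree sum `2 * (n - 1)`; it is an equality for
  -- degrees 1, 2 and 3.
  have hpt : ∀ v, 2 * (if T.degree v ≠ 1 then 1 else 0) + 1 ≤
      T.degree v + if T.degree v = 2 then 1 else 0 := by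
    intro v
    have := hT.connected.preconnected.degree_pos_of_nontrivial v
    split_ifs <;> omega
  have := Finset.sum_le_sum fun v (_ : v ∈ Finset.univ) => hpt v
  rw [Finset.sum_add_distrib, Finset.sum_add_distrib, ← Finset.mul_sum, ← Finset.card_filter,
    ← Finset.card_filter, hsum] at this
  simp only [Finset.sum_const, Finset.card_univ, smul_eq_mul, mul_one] at this
  omega

theorem IsTree.burningNumber_le [Fintype V] {G : SimpleGraph V} [DecidableRel T.Adj]
    (hTG : T ≤ G) (hT : T.IsTree) {k : ℕ} (hk : 0 < k) (hn : Fintype.card V ≤ k * k)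
    (hdeg : (Finset.univ.filter fun v : V => T.degree v = 2).card < k) :
    G.burningNumber ≤ k := by
  classical
  have hp' : ∀ {ρ : V} {p : V → V}, p ρ = ρ → (∀ v ≠ ρ, T.Adj v (p v)) →
      ∀ v, p v = v ∨ G.Adj v (p v) := fun {ρ p} h₁ h₂ v => by
    by_cases hv : v = ρ
    · exact Or.inl (by rw [hv, h₁])
    · exact Or.inr (hTG (h₂ v hv))
  have hne : ∀ ρ u v : V, T.dist ρ u = 0 → T.dist ρ v = 0 → u = v := fun ρ u v hu hv =>
    (hT.connected.dist_eq_zero_iff.1 hu).symm.trans (hT.connected.dist_eq_zero_iff.1 hv)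
  -- With fewer than three vertices there may be no non-leaf to serve as root; a single ball of
  -- radius `k - 1` suffices.
  rcases Nat.lt_or_ge (Fintype.card V) 3 with hsmall | hbig
  · obtain ⟨ρ⟩ := hT.connected.nonempty
    obtain ⟨p, hp, hpρ, hadj⟩ := hT.connected.exists_isParentDepth ρ
    obtain ⟨c, hc⟩ := hp.exists_center (A := Finset.univ) (by simp) (hne ρ) ρ (k - 1) (by
      rw [Finset.card_univ]
      rcases Nat.lt_or_ge k 2 with h | h
      · obtain rfl : k = 1 := by omega
        simpa using hn
      · omega)
    refine G.burningNumber_le_of_cover k (fun _ => c) fun v => ?_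
    obtain ⟨a, b, hab, h⟩ := hc v (Finset.mem_univ v)
    obtain ⟨w, hw⟩ := exists_walk_of_iterate_eq (hp' hpρ hadj) h
    exact ⟨k - 1, by omega, w, by omega⟩
  · have hleaf := hT.two_mul_card_degree_ne_one_add_two_le (by omega)
    obtain ⟨s, rfl⟩ : ∃ s, k = s + 2 := ⟨k - 2, by
      have : k ≠ 1 := by rintro rfl; omega
      omega⟩
    have : Nontrivial V := Fintype.one_lt_card_iff_nontrivial.1 (by omega)
    obtain ⟨ρ, hρ⟩ : ∃ ρ, T.degree ρ ≠ 1 := by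
      by_contra! hall
      have hsum := T.sum_degrees_eq_twice_card_edges
      have hedge := hT.card_edgeFinset
      simp only [hall, Finset.sum_const, Finset.card_univ, smul_eq_mul, mul_one] at hsum
      omega
    obtain ⟨p, hp, hpρ, hadj⟩ := hT.connected.exists_isParentDepth ρ
    -- A parent other than the root has both a child and a parent, at different depths. So the
    -- non-leaves are parent-closed, and every leaf hangs on one.
    have hpdeg : ∀ v, T.degree (p v) ≠ 1 := by
      intro v hv
      by_cases hpv : p v = ρ
      · exact hρ (hpv ▸ hv)
      have hvρ : v ≠ ρ := fun h => hpv (by rw [h, hpρ])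
      obtain ⟨x, -, hx⟩ := degree_eq_one_iff_existsUnique_adj.1 hv
      have h1 : v = p (p v) := (hx v (hadj v hvρ).symm).trans (hx _ (hadj _ hpv)).symm
      have h2 := hp.depth_parent v
      have h3 := hp.depth_parent (p v)
      have h4 : T.dist ρ v ≠ 0 := fun h => hvρ (hT.connected.dist_eq_zero_iff.1 h).symm
      rw [← h1] at h3
      omega
    obtain ⟨c, hc⟩ := hp.exists_cover (A := Finset.univ.filter fun v => T.degree v ≠ 1)
      (fun v _ => by simpa using hpdeg v) (hne ρ) ρ s (by
        have h₁ : (s + 2) * (s + 2) = s * s + 4 * s + 4 := by ring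
        -- The count only gives `s * s + 5 * s + 3`; parity saves the last unit.
        have h₂ : (s * s + 5 * s) % 2 = 0 := by
          rcases Nat.even_or_odd' s with ⟨t, rfl | rfl⟩
          · exact Nat.mod_eq_zero_of_dvd ⟨t * (2 * t + 5), by ring⟩
          · exact Nat.mod_eq_zero_of_dvd ⟨(2 * t + 1) * (t + 3), by ring⟩
        rw [h₁] at hn
        generalize s * s = q at hn h₂ ⊢
        omega)
    -- The shift raises each radius by one, to reach `v` from `p v`; the ball of radius `0` is not
    -- needed.
    refine G.burningNumber_le_of_cover (s + 2) (fun r => c (r - 1)) fun v => ?_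
    obtain ⟨r, hr, a, b, hab, h⟩ := hc (p v) (by simpa using hpdeg v)
    rw [← Function.iterate_succ_apply] at h
    obtain ⟨w, hw⟩ := exists_walk_of_iterate_eq (hp' hpρ hadj) h
    exact ⟨r + 1, by omega, w, by omega⟩

end SimpleGraph

theorem mainTheorem5 {V : Type*} [Fintype V] (G : SimpleGraph V) (n : ℕ)
    (hn : Fintype.card V = n)
    (T : SimpleGraph V) [DecidableRel T.Adj] (hTG : T ≤ G) (hT : T.IsTree)
    (hdeg : (Finset.univ.filter (fun v : V => T.degree v = 2)).card ≤ ⌊√((n : ℝ) - 1)⌋₊) :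
    G.burningNumber ≤ ⌈√(n : ℝ)⌉₊ := by
  have hpos : 0 < n := by
    have := hT.connected.nonempty
    exact hn ▸ Fintype.card_pos
  have hn1 : (1 : ℝ) ≤ n := by exact_mod_cast hpos
  have hceil := Nat.le_ceil √(n : ℝ)
  refine hT.burningNumber_le hTG (Nat.ceil_pos.2 (Real.sqrt_pos.2 (by linarith))) ?_
    (hdeg.trans_lt ((Nat.floor_lt (Real.sqrt_nonneg _)).2 ((Real.sqrt_lt_sqrt (by linarith)
      (by linarith)).trans_le hceil)))
  rw [hn]
  have := Real.mul_self_sqrt (show (0 : ℝ) ≤ n by linarith)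
  exact_mod_cast this.symm.trans_le (mul_self_le_mul_self (Real.sqrt_nonneg _) hceil)
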